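/- An operator space is a complex Banach space $X$ together with norms $\|\cdot\|_n$ on the spaces $M_n(X)$ of $n\times n$ matrices over $X$, $n\in\mathbb N$, such that $\|\cdot\|_1$ is the norm of $X$ (under $M_1(X)\cong X$), $\|x\oplus y\|_{m+n}=\max\{\|x\|_m,\|y\|_n\}$ for $x\in M_m(X)$, $y\in M_n(X)$, and $\|\alpha x\beta\|_m\le\|\alpha\|\,\|x\|_m\,\|\beta\|$ for $x\in M_m(X)$ and $\alpha,\beta\in M_m(\mathbb C)$, where scalar matrices carry the operator norm on $\mathbb C^m$. Such a family of norms is called an operator space structure on $X$. Let $\mathbf{OS}$ be the category of operator spaces and linear complete contractions, i.e. linear maps $u\colon X\to Y$ with $\|[u(x_{ij})]\|_n\le\|[x_{ij}]\|_n$ for all $n$ and all $[x_{ij}]\in M_n(X)$. The operator space $\mathbb C$ is $\mathbb C$ with the operator norms on $M_n(\mathbb C)$. For a complex Banach space $X$, let $\mathrm{Max}(X)$ and $\mathrm{Min}(X)$ denote $X$ equipped with the largest, respectively the smallest, operator space structure on $X$. An object $S$ of a category is a generator if for any two distinct morphisms $f,g\colon A\to B$ there is $s\colon S\to A$ with $f\circ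 s\ne g\circ s$; a generator $S$ is strong if for every monomorphism $m\colon A\to B$ that is not an isomorphism there is a morphism $S\to B$ that does not factor through $m$. **Proposition.** The operator space $\mathbb C$ is a generator of $\mathbf{OS}$, but it is not a strong generator. Moreover, if $X$ is a complex Banach space such that $\mathrm{Max}(X)$ and $\mathrm{Min}(X)$ are not isomorphic in $\mathbf{OS}$, then the identity map $\mathrm{Max}(X)\to\mathrm{Min}(X)$ is a monomorphism in $\mathbf{OS}$ that is not an isomorphism, and every morphism $\mathbb C\to\mathrm{Min}(X)$ in $\mathbf{OS}$ factors through it. -/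

import Mathlib

open CategoryTheory

universe u

noncomputable section

namespace OperatorSpaces

/-- The norm of a square complex matrix as an operator on the Hilbert space `ℂⁿ`. -/
def opNorm {n : ℕ} (a : Matrix (Fin n) (Fin n) ℂ) : ℝ :=
  ‖Matrix.toEuclideanCLM (n := Fin n) (𝕜 := ℂ) a‖

section MatrixOperations

variable {X : Type u} [AddCommGroup X] [Module ℂ X]

/-- The block diagonal matrix `x ⊕ y`. -/
def directSum {m n : ℕ} (x : Matrix (Fin m) (Fin m) X) (y : Matrix (Fin n) (Fin n) X) :
    Matrix (Fin (m + n)) (Fin (m + n)) X :=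
  Matrix.reindex finSumFinEquiv finSumFinEquiv (Matrix.fromBlocks x 0 0 y)

/-- The product `α x β` of a matrix `x` over a complex vector space with scalar matrices
`α` and `β`. -/
def bimul {n : ℕ} (α : Matrix (Fin n) (Fin n) ℂ) (x : Matrix (Fin n) (Fin n) X)
    (β : Matrix (Fin n) (Fin n) ℂ) : Matrix (Fin n) (Fin n) X :=
  Matrix.of fun i j => ∑ k, ∑ l, (α i k * β l j) • x k l

end MatrixOperations

/-- An operator space structure on a complex normed space `X`: a family of norms on the matrix
spaces `Mₙ(X)` satisfying the axioms (M1) and (M2), whose first member is the norm of `X` under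
the identification `M₁(X) ≅ X`. (For `n = 0` the matrix space is zero.) -/
@[ext]
structure OSStructure (X : Type u) [NormedAddCommGroup X] [NormedSpace ℂ X] where
  nrm : (n : ℕ) → Matrix (Fin n) (Fin n) X → ℝ
  nrm_nonneg : ∀ n x, 0 ≤ nrm n x
  nrm_add_le : ∀ n x y, nrm n (x + y) ≤ nrm n x + nrm n y
  nrm_smul : ∀ n (c : ℂ) x, nrm n (c • x) = ‖c‖ * nrm n x
  eq_zero_of_nrm : ∀ n x, nrm n x = 0 → x = 0
  nrm_one : ∀ x : X, nrm 1 (Matrix.of fun _ _ => x) = ‖x‖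
  nrm_directSum : ∀ m n (x : Matrix (Fin m) (Fin m) X) (y : Matrix (Fin n) (Fin n) X),
    nrm (m + n) (directSum x y) = max (nrm m x) (nrm n y)
  nrm_bimul_le : ∀ n (α : Matrix (Fin n) (Fin n) ℂ) (x : Matrix (Fin n) (Fin n) X)
    (β : Matrix (Fin n) (Fin n) ℂ), nrm n (bimul α x β) ≤ opNorm α * nrm n x * opNorm β

/-! ### The operator norm of scalar matrices -/

section OpNorm

variable {n : ℕ}

theorem opNorm_nonneg (a : Matrix (Fin n) (Fin n) ℂ) : 0 ≤ opNorm a := norm_nonneg _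

theorem opNorm_add_le (a b : Matrix (Fin n) (Fin n) ℂ) : opNorm (a + b) ≤ opNorm a + opNorm b := by
  unfold opNorm; rw [map_add]; exact norm_add_le _ _

theorem opNorm_smul (c : ℂ) (a : Matrix (Fin n) (Fin n) ℂ) : opNorm (c • a) = ‖c‖ * opNorm a := by
  unfold opNorm; rw [map_smul]; exact norm_smul _ _

theorem opNorm_mul_le (a b : Matrix (Fin n) (Fin n) ℂ) : opNorm (a * b) ≤ opNorm a * opNorm b := by
  unfold opNorm; rw [map_mul]; exact norm_mul_le _ _

theorem eq_zero_of_opNorm (a : Matrix (Fin n) (Fin n) ℂ) (h : opNorm a = 0) : a = 0 := by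
  unfold opNorm at h
  rw [norm_eq_zero] at h
  exact (map_eq_zero_iff _ (Matrix.toEuclideanCLM (n := Fin n) (𝕜 := ℂ)).injective).1 h

theorem norm_toLp_mulVec_le (a : Matrix (Fin n) (Fin n) ℂ) (v : Fin n → ℂ) :
    ‖WithLp.toLp 2 (a.mulVec v)‖ ≤ opNorm a * ‖WithLp.toLp 2 v‖ := by
  have := (Matrix.toEuclideanCLM (n := Fin n) (𝕜 := ℂ) a).le_opNorm (WithLp.toLp 2 v)
  rwa [Matrix.toEuclideanCLM_toLp] at this

theorem opNorm_le_of (a : Matrix (Fin n) (Fin n) ℂ) {C : ℝ} (hC : 0 ≤ C)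
    (h : ∀ v : Fin n → ℂ, ‖WithLp.toLp 2 (a.mulVec v)‖ ≤ C * ‖WithLp.toLp 2 v‖) : opNorm a ≤ C := by
  refine ContinuousLinearMap.opNorm_le_bound _ hC fun v => ?_
  have := h v.ofLp
  rwa [← Matrix.toEuclideanCLM_toLp] at this

theorem opNorm_one_one (c : ℂ) : opNorm (Matrix.of fun _ _ : Fin 1 => c) = ‖c‖ := by
  have key : ∀ v : Fin 1 → ℂ,
      ‖WithLp.toLp 2 ((Matrix.of fun _ _ : Fin 1 => c).mulVec v)‖ = ‖c‖ * ‖WithLp.toLp 2 v‖ := by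
    intro v
    have h : 0 ≤ ‖c‖ * ‖v 0‖ := by positivity
    simp [EuclideanSpace.norm_eq, Matrix.mulVec, dotProduct, Real.sqrt_sq h]
  refine le_antisymm (opNorm_le_of _ (norm_nonneg _) fun v => (key v).le) ?_
  have h := norm_toLp_mulVec_le (Matrix.of fun _ _ : Fin 1 => c) (fun _ => 1)
  rw [key] at h
  simpa [EuclideanSpace.norm_eq] using h

theorem opNorm_vecMulVec_le (u w : Fin n → ℂ) :
    opNorm (Matrix.vecMulVec u (star w)) ≤ ‖WithLp.toLp 2 u‖ * ‖WithLp.toLp 2 w‖ := by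
  refine opNorm_le_of _ (by positivity) fun v => ?_
  have h1 : (Matrix.vecMulVec u (star w)).mulVec v =
      (inner ℂ (WithLp.toLp 2 w) (WithLp.toLp 2 v) : ℂ) • u := by
    ext i
    simp only [Matrix.mulVec, dotProduct, Matrix.vecMulVec_apply, Pi.star_apply, PiLp.inner_apply,
      RCLike.inner_apply, Pi.smul_apply, smul_eq_mul, Finset.sum_mul, RCLike.star_def]
    exact Finset.sum_congr rfl fun j _ => by ring
  rw [h1, WithLp.toLp_smul, norm_smul]
  nlinarith [norm_inner_le_norm (𝕜 := ℂ) (WithLp.toLp 2 w) (WithLp.toLp 2 v),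
    norm_nonneg (WithLp.toLp 2 u)]

theorem norm_sq_append {m n : ℕ} (v : Fin (m + n) → ℂ) :
    ‖WithLp.toLp 2 v‖ ^ 2 = ‖WithLp.toLp 2 (fun i => v (Fin.castAdd n i))‖ ^ 2 +
      ‖WithLp.toLp 2 (fun i => v (Fin.natAdd m i))‖ ^ 2 := by
  simp [EuclideanSpace.norm_sq_eq, Fin.sum_univ_add]

theorem directSum_mulVec_castAdd {m n : ℕ} (a : Matrix (Fin m) (Fin m) ℂ)
    (b : Matrix (Fin n) (Fin n) ℂ) (v : Fin (m + n) → ℂ) (i : Fin m) :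
    (directSum a b).mulVec v (Fin.castAdd n i) = a.mulVec (fun i => v (Fin.castAdd n i)) i := by
  simp [directSum, Matrix.mulVec, dotProduct, Fin.sum_univ_add]

theorem directSum_mulVec_natAdd {m n : ℕ} (a : Matrix (Fin m) (Fin m) ℂ)
    (b : Matrix (Fin n) (Fin n) ℂ) (v : Fin (m + n) → ℂ) (i : Fin n) :
    (directSum a b).mulVec v (Fin.natAdd m i) = b.mulVec (fun i => v (Fin.natAdd m i)) i := by
  simp [directSum, Matrix.mulVec, dotProduct, Fin.sum_univ_add]

theorem norm_sq_directSum_mulVec {m n : ℕ} (a : Matrix (Fin m) (Fin m) ℂ)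
    (b : Matrix (Fin n) (Fin n) ℂ) (v : Fin (m + n) → ℂ) :
    ‖WithLp.toLp 2 ((directSum a b).mulVec v)‖ ^ 2 =
      ‖WithLp.toLp 2 (a.mulVec fun i => v (Fin.castAdd n i))‖ ^ 2 +
      ‖WithLp.toLp 2 (b.mulVec fun i => v (Fin.natAdd m i))‖ ^ 2 := by
  rw [norm_sq_append]
  simp only [directSum_mulVec_castAdd, directSum_mulVec_natAdd]

theorem opNorm_directSum {m n : ℕ} (a : Matrix (Fin m) (Fin m) ℂ) (b : Matrix (Fin n) (Fin n) ℂ) :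
    opNorm (directSum a b) = max (opNorm a) (opNorm b) := by
  have hM : 0 ≤ max (opNorm a) (opNorm b) := le_max_of_le_left (opNorm_nonneg a)
  refine le_antisymm (opNorm_le_of _ hM fun v => ?_) (max_le ?_ ?_)
  · refine le_of_sq_le_sq ?_ (by positivity)
    rw [mul_pow, norm_sq_append v, norm_sq_directSum_mulVec, mul_add, ← mul_pow, ← mul_pow]
    gcongr
    · exact (norm_toLp_mulVec_le _ _).trans (by gcongr; exact le_max_left _ _)
    · exact (norm_toLp_mulVec_le _ _).trans (by gcongr; exact le_max_right _ _)
  · refine opNorm_le_of _ (opNorm_nonneg _) fun v => ?_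
    have h := norm_toLp_mulVec_le (directSum a b) (Fin.append v 0)
    have h1 := norm_sq_directSum_mulVec a b (Fin.append v 0)
    have h2 := norm_sq_append (Fin.append v (0 : Fin n → ℂ))
    simp only [Fin.append_left, Fin.append_right, Pi.zero_apply] at h1 h2
    have h0 : ‖WithLp.toLp 2 (fun _ : Fin n => (0 : ℂ))‖ = 0 := by
      simp [EuclideanSpace.norm_eq]
    rw [h0] at h2
    have h3 : ‖WithLp.toLp 2 (Fin.append v (0 : Fin n → ℂ))‖ = ‖WithLp.toLp 2 v‖ :=
      (sq_eq_sq₀ (norm_nonneg _) (norm_nonneg _)).1 (by simpa using h2)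
    rw [h3] at h
    refine le_trans (le_of_sq_le_sq ?_ (norm_nonneg _)) h
    rw [h1]
    exact le_add_of_nonneg_right (by positivity)
  · refine opNorm_le_of _ (opNorm_nonneg _) fun v => ?_
    have h := norm_toLp_mulVec_le (directSum a b) (Fin.append 0 v)
    have h1 := norm_sq_directSum_mulVec a b (Fin.append 0 v)
    have h2 := norm_sq_append (Fin.append (0 : Fin m → ℂ) v)
    simp only [Fin.append_left, Fin.append_right, Pi.zero_apply] at h1 h2
    have h0 : ‖WithLp.toLp 2 (fun _ : Fin m => (0 : ℂ))‖ = 0 := by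
      simp [EuclideanSpace.norm_eq]
    rw [h0] at h2
    have h3 : ‖WithLp.toLp 2 (Fin.append (0 : Fin m → ℂ) v)‖ = ‖WithLp.toLp 2 v‖ :=
      (sq_eq_sq₀ (norm_nonneg _) (norm_nonneg _)).1 (by simpa using h2)
    rw [h3] at h
    refine le_trans (le_of_sq_le_sq ?_ (norm_nonneg _)) h
    rw [h1]
    exact le_add_of_nonneg_left (by positivity)

theorem opNorm_le_of_sesq (a : Matrix (Fin n) (Fin n) ℂ) {C : ℝ} (hC : 0 ≤ C)
    (h : ∀ v w : Fin n → ℂ, ‖∑ i, ∑ j, (star (w i) * v j) * a i j‖ ≤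
      C * ‖WithLp.toLp 2 w‖ * ‖WithLp.toLp 2 v‖) : opNorm a ≤ C := by
  refine opNorm_le_of _ hC fun v => ?_
  have h1 := h v (a.mulVec v)
  have h2 : ∑ i, ∑ j, (star (a.mulVec v i) * v j) * a i j =
      inner ℂ (WithLp.toLp 2 (a.mulVec v)) (WithLp.toLp 2 (a.mulVec v)) := by
    simp only [PiLp.inner_apply, RCLike.inner_apply]
    refine Finset.sum_congr rfl fun i _ => ?_
    conv_rhs => rw [Matrix.mulVec, dotProduct]
    rw [Finset.sum_mul]
    exact Finset.sum_congr rfl fun j _ => by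
      simp only [RCLike.star_def, Matrix.mulVec, dotProduct]; ring
  rw [h2, inner_self_eq_norm_sq_to_K, norm_pow, RCLike.norm_ofReal, abs_norm] at h1
  rcases (norm_nonneg (WithLp.toLp 2 (a.mulVec v))).eq_or_lt with h0 | h0
  · rw [← h0]; positivity
  · nlinarith

end OpNorm

/-! ### Bounds valid for every operator space structure -/

section Bounds

variable {X : Type u} [NormedAddCommGroup X] [NormedSpace ℂ X]

theorem OSStructure.nrm_zero (s : OSStructure X) (n : ℕ) : s.nrm n 0 = 0 := by
  simpa using s.nrm_smul n 0 0

theorem OSStructure.nrm_single_last (s : OSStructure X) (k : ℕ) (v : X) :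
    s.nrm (k + 1) (Matrix.single (Fin.last k) (Fin.last k) v) = ‖v‖ := by
  have h : Matrix.single (Fin.last k) (Fin.last k) v =
      directSum (0 : Matrix (Fin k) (Fin k) X) (Matrix.of fun _ _ : Fin 1 => v) := by
    ext i j
    refine Fin.addCases (fun i => ?_) (fun i => ?_) i <;>
      refine Fin.addCases (fun j => ?_) (fun j => ?_) j <;>
      simp [directSum, Matrix.single_apply, Fin.ext_iff] <;> omega
  rw [h, s.nrm_directSum, s.nrm_one, s.nrm_zero]
  exact max_eq_right (norm_nonneg v)

/-- The vector coefficient of a matrix is bounded by its norm. -/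
theorem OSStructure.norm_sesq_le (s : OSStructure X) (n : ℕ) (x : Matrix (Fin n) (Fin n) X)
    (v w : Fin n → ℂ) :
    ‖∑ i, ∑ j, (star (w i) * v j) • x i j‖ ≤
      s.nrm n x * ‖WithLp.toLp 2 w‖ * ‖WithLp.toLp 2 v‖ := by
  cases n with
  | zero =>
    have h0 := s.nrm_nonneg 0 x
    simp only [Finset.univ_eq_empty, Finset.sum_empty, norm_zero]
    positivity
  | succ k =>
    set e : Fin (k + 1) → ℂ := Pi.single (Fin.last k) 1 with he
    have hn : ‖WithLp.toLp 2 e‖ = 1 := by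
      rw [he]; simp
    have hs : star e = e := by
      ext i; by_cases hi : i = Fin.last k <;> simp [he, hi]
    have h1 : bimul (Matrix.vecMulVec e (star w)) x (Matrix.vecMulVec v (star e)) =
        Matrix.single (Fin.last k) (Fin.last k) (∑ i, ∑ j, (star (w i) * v j) • x i j) := by
      ext i j
      rw [hs]
      by_cases hi : i = Fin.last k <;> by_cases hj : j = Fin.last k <;>
        simp [bimul, Matrix.vecMulVec_apply, he, Pi.single_apply, hi, hj,
          eq_comm]
    rw [← s.nrm_single_last k, ← h1]
    refine (s.nrm_bimul_le _ _ _ _).trans ?_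
    have ha := opNorm_vecMulVec_le e w
    have hb := opNorm_vecMulVec_le v e
    rw [hn] at ha hb
    have h0 := s.nrm_nonneg (k + 1) x
    calc opNorm (Matrix.vecMulVec e (star w)) * s.nrm (k + 1) x
          * opNorm (Matrix.vecMulVec v (star e))
        ≤ (1 * ‖WithLp.toLp 2 w‖) * s.nrm (k + 1) x * (‖WithLp.toLp 2 v‖ * 1) := by
          gcongr
          exact opNorm_nonneg _
      _ = _ := by ring

theorem OSStructure.nrm_single_le (s : OSStructure X) {n : ℕ} (i j : Fin n) (v : X) :
    s.nrm n (Matrix.single i j v) ≤ ‖v‖ := by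
  cases n with
  | zero => exact i.elim0
  | succ k =>
    set e : Fin (k + 1) → Fin (k + 1) → ℂ := fun i => Pi.single i 1 with he
    have hn : ∀ i, ‖WithLp.toLp 2 (e i)‖ = 1 := fun i => by simp [he]
    have hs : ∀ i, star (e i) = e i := fun i => by
      ext l; by_cases hl : l = i <;> simp [he, hl]
    have h1 : bimul (Matrix.vecMulVec (e i) (star (e (Fin.last k))))
        (Matrix.single (Fin.last k) (Fin.last k) v)
        (Matrix.vecMulVec (e (Fin.last k)) (star (e j))) = Matrix.single i j v := by
      ext p q
      rw [hs, hs]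
      simp only [bimul, Matrix.of_apply, Matrix.vecMulVec_apply]
      rw [Finset.sum_eq_single (Fin.last k), Finset.sum_eq_single (Fin.last k)]
      · by_cases hp : p = i <;> by_cases hq : q = j <;>
          simp [he, hp, hq, Ne.symm]
      · intro l _ hl
        simp [he, Pi.single_apply, hl]
      · simp
      · intro l _ hl
        simp [he, Pi.single_apply, hl]
      · simp
    rw [← h1]
    refine (s.nrm_bimul_le _ _ _ _).trans ?_
    rw [s.nrm_single_last]
    have ha := opNorm_vecMulVec_le (e i) (e (Fin.last k))
    have hb := opNorm_vecMulVec_le (e (Fin.last k)) (e j)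
    rw [hn, hn] at ha hb
    calc _ ≤ (1 * 1) * ‖v‖ * (1 * 1) := by
          gcongr
          exact opNorm_nonneg _
      _ = _ := by ring

theorem OSStructure.nrm_sum_le (s : OSStructure X) (n : ℕ) {ι : Type} (t : Finset ι)
    (f : ι → Matrix (Fin n) (Fin n) X) : s.nrm n (∑ i ∈ t, f i) ≤ ∑ i ∈ t, s.nrm n (f i) := by
  classical
  induction t using Finset.induction_on with
  | empty => simp [s.nrm_zero]
  | insert a t ha ih =>
    rw [Finset.sum_insert ha, Finset.sum_insert ha]
    exact (s.nrm_add_le _ _ _).trans (by gcongr)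

theorem OSStructure.nrm_le_sum (s : OSStructure X) (n : ℕ) (x : Matrix (Fin n) (Fin n) X) :
    s.nrm n x ≤ ∑ i, ∑ j, ‖x i j‖ := by
  conv_lhs => rw [Matrix.matrix_eq_sum_single x]
  refine (s.nrm_sum_le _ _ _).trans (Finset.sum_le_sum fun i _ => ?_)
  exact (s.nrm_sum_le _ _ _).trans (Finset.sum_le_sum fun j _ => s.nrm_single_le i j _)

end Bounds

/-! ### The operator space `ℂ` -/

theorem bimul_eq_mul {n : ℕ} (α x β : Matrix (Fin n) (Fin n) ℂ) : bimul α x β = α * x * β := by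
  ext i j
  simp only [bimul, Matrix.of_apply, Matrix.mul_apply, smul_eq_mul, Finset.sum_mul]
  rw [Finset.sum_comm]
  exact Finset.sum_congr rfl fun _ _ => Finset.sum_congr rfl fun _ _ => by ring

theorem map_directSum {X : Type u} [AddCommGroup X] [Module ℂ X] (f : X →ₗ[ℂ] ℂ)
    {m n : ℕ} (x : Matrix (Fin m) (Fin m) X) (y : Matrix (Fin n) (Fin n) X) :
    (directSum x y).map f = directSum (x.map f) (y.map f) := by
  ext i j
  refine Fin.addCases (fun i => ?_) (fun i => ?_) i <;>
    refine Fin.addCases (fun j => ?_) (fun j => ?_) j <;> simp [directSum]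

theorem map_bimul {X : Type u} [AddCommGroup X] [Module ℂ X] (f : X →ₗ[ℂ] ℂ) {n : ℕ}
    (α : Matrix (Fin n) (Fin n) ℂ) (x : Matrix (Fin n) (Fin n) X) (β : Matrix (Fin n) (Fin n) ℂ) :
    (bimul α x β).map f = α * x.map f * β := by
  rw [← bimul_eq_mul]
  ext i j
  simp [bimul]

theorem map_add' {X : Type u} [AddCommGroup X] [Module ℂ X] (f : X →ₗ[ℂ] ℂ) {n : ℕ}
    (x y : Matrix (Fin n) (Fin n) X) : (x + y).map f = x.map f + y.map f := by
  ext i j; simp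

theorem map_smul' {X : Type u} [AddCommGroup X] [Module ℂ X] (f : X →ₗ[ℂ] ℂ) {n : ℕ}
    (c : ℂ) (x : Matrix (Fin n) (Fin n) X) : (c • x).map f = c • x.map f := by
  ext i j; simp

/-- The linear isomorphism between the copy of `ℂ` in the universe `u` and `ℂ`. -/
def down : ULift.{u} ℂ →ₗ[ℂ] ℂ := (ULift.moduleEquiv : ULift.{u} ℂ ≃ₗ[ℂ] ℂ).toLinearMap

@[simp] theorem down_apply (x : ULift.{u} ℂ) : down x = x.down := rfl

/-- The operator space structure of `ℂ`: the norm of `Mₙ(ℂ)` is the operator norm. -/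
def complexStructure : OSStructure (ULift.{u} ℂ) where
  nrm n x := opNorm (x.map down)
  nrm_nonneg n x := opNorm_nonneg _
  nrm_add_le n x y := by rw [map_add']; exact opNorm_add_le _ _
  nrm_smul n c x := by rw [map_smul']; exact opNorm_smul _ _
  eq_zero_of_nrm n x h := by
    have h0 := eq_zero_of_opNorm _ h
    ext i j
    exact congrFun (congrFun h0 i) j
  nrm_one x := by
    exact opNorm_one_one x.down
  nrm_directSum m n x y := by rw [map_directSum]; exact opNorm_directSum _ _
  nrm_bimul_le n α x β := by
    rw [map_bimul]
    exact (opNorm_mul_le _ _).trans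
      (mul_le_mul_of_nonneg_right (opNorm_mul_le _ _) (opNorm_nonneg _))

/-! ### The minimal and the maximal operator space structure -/

section MinMax

variable (X : Type u) [NormedAddCommGroup X] [NormedSpace ℂ X]

/-- The closed unit ball of the dual space. -/
abbrev DualBall : Type u := {f : X →L[ℂ] ℂ // ‖f‖ ≤ 1}

instance : Nonempty (DualBall X) := ⟨⟨0, by simp⟩⟩

variable {X}

/-- `‖x‖ = sup { ‖[f(xᵢⱼ)]‖ : f ∈ X*, ‖f‖ ≤ 1 }`. -/
def minNrm (n : ℕ) (x : Matrix (Fin n) (Fin n) X) : ℝ :=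
  ⨆ f : DualBall X, opNorm (x.map f.1)

theorem opNorm_map_le (s : OSStructure X) (f : DualBall X) (n : ℕ)
    (x : Matrix (Fin n) (Fin n) X) : opNorm (x.map f.1) ≤ s.nrm n x := by
  refine opNorm_le_of_sesq _ (s.nrm_nonneg n x) fun v w => ?_
  have h : ∑ i, ∑ j, (star (w i) * v j) * (x.map f.1) i j =
      f.1 (∑ i, ∑ j, (star (w i) * v j) • x i j) := by
    simp [map_sum]
  rw [h]
  refine (f.1.le_of_opNorm_le f.2 _).trans ?_
  rw [one_mul]
  exact s.norm_sesq_le n x v w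

theorem opNorm_le_sum {n : ℕ} (a : Matrix (Fin n) (Fin n) ℂ) :
    opNorm a ≤ ∑ i, ∑ j, ‖a i j‖ :=
  complexStructure.{0}.nrm_le_sum n (a.map ULift.up)

theorem bddAbove_minNrm (n : ℕ) (x : Matrix (Fin n) (Fin n) X) :
    BddAbove (Set.range fun f : DualBall X => opNorm (x.map f.1)) := by
  refine ⟨∑ i, ∑ j, ‖x i j‖, ?_⟩
  rintro _ ⟨f, rfl⟩
  refine (opNorm_le_sum _).trans ?_
  gcongr with i _ j _
  simpa using f.1.le_of_opNorm_le f.2 (x i j)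

theorem le_minNrm (n : ℕ) (x : Matrix (Fin n) (Fin n) X) (f : DualBall X) :
    opNorm (x.map f.1) ≤ minNrm n x := le_ciSup (bddAbove_minNrm n x) f

theorem minNrm_nonneg (n : ℕ) (x : Matrix (Fin n) (Fin n) X) : 0 ≤ minNrm n x :=
  Real.iSup_nonneg fun _ => opNorm_nonneg _

variable (X)

/-- The minimal operator space structure on a normed space. -/
def minStructure : OSStructure X where
  nrm n x := minNrm n x
  nrm_nonneg n x := minNrm_nonneg n x
  nrm_add_le n x y := ciSup_le fun f => by
    have h : (x + y).map f.1 = x.map f.1 + y.map f.1 := map_add' f.1.toLinearMap x y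
    rw [h]
    exact (opNorm_add_le _ _).trans (add_le_add (le_minNrm n x f) (le_minNrm n y f))
  nrm_smul n c x := by
    have h : ∀ f : DualBall X, opNorm ((c • x).map f.1) = ‖c‖ * opNorm (x.map f.1) := fun f => by
      have h : (c • x).map f.1 = c • x.map f.1 := map_smul' f.1.toLinearMap c x
      rw [h, opNorm_smul]
    simp only [minNrm, h]
    exact (Real.mul_iSup_of_nonneg (norm_nonneg c) _).symm
  eq_zero_of_nrm n x hx := by
    ext i j
    obtain ⟨g, hg, hgx⟩ := exists_dual_vector'' ℂ (x i j)
    have h1 : opNorm (x.map g) = 0 :=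
      le_antisymm ((le_minNrm n x ⟨g, hg⟩).trans hx.le) (opNorm_nonneg _)
    have h2 := congrFun (congrFun (eq_zero_of_opNorm _ h1) i) j
    have h3 : g (x i j) = 0 := h2
    rw [hgx] at h3
    simpa using h3
  nrm_one x := by
    have h : ∀ f : DualBall X, opNorm ((Matrix.of fun _ _ : Fin 1 => x).map f.1) = ‖f.1 x‖ :=
      fun f => opNorm_one_one (f.1 x)
    refine le_antisymm (ciSup_le fun f => ?_) ?_
    · rw [h]
      simpa using f.1.le_of_opNorm_le f.2 x
    · obtain ⟨g, hg, hgx⟩ := exists_dual_vector'' ℂ x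
      have h1 := le_minNrm 1 (Matrix.of fun _ _ : Fin 1 => x) ⟨g, hg⟩
      rw [h, hgx] at h1
      simpa using h1
  nrm_directSum m n x y := by
    have h : ∀ f : DualBall X, opNorm ((directSum x y).map f.1) =
        max (opNorm (x.map f.1)) (opNorm (y.map f.1)) := fun f => by
      have h : (directSum x y).map f.1 = directSum (x.map f.1) (y.map f.1) :=
        map_directSum f.1.toLinearMap x y
      rw [h, opNorm_directSum]
    refine le_antisymm (ciSup_le fun f => ?_) (max_le (ciSup_le fun f => ?_) (ciSup_le fun f => ?_))
    · rw [h]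
      exact max_le_max (le_minNrm m x f) (le_minNrm n y f)
    · exact ((le_max_left _ _).trans (h f).ge).trans (le_minNrm _ _ f)
    · exact ((le_max_right _ _).trans (h f).ge).trans (le_minNrm _ _ f)
  nrm_bimul_le n α x β := ciSup_le fun f => by
    have h : (bimul α x β).map f.1 = α * x.map f.1 * β := map_bimul f.1.toLinearMap α x β
    rw [h]
    refine (opNorm_mul_le _ _).trans
      (mul_le_mul_of_nonneg_right ((opNorm_mul_le _ _).trans ?_) (opNorm_nonneg _))
    exact mul_le_mul_of_nonneg_left (le_minNrm n x f) (opNorm_nonneg _)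

variable {X}

/-- `minStructure X` is the smallest operator space structure on `X`. -/
theorem minStructure_le (s : OSStructure X) (n : ℕ) (x : Matrix (Fin n) (Fin n) X) :
    (minStructure X).nrm n x ≤ s.nrm n x :=
  ciSup_le fun f => opNorm_map_le s f n x

instance : Nonempty (OSStructure X) := ⟨minStructure X⟩

/-- The supremum of the norms of `x` in all operator space structures on `X`. -/
def maxNrm (n : ℕ) (x : Matrix (Fin n) (Fin n) X) : ℝ :=
  ⨆ s : OSStructure X, s.nrm n x

theorem le_maxNrm (s : OSStructure X) (n : ℕ) (x : Matrix (Fin n) (Fin n) X) :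
    s.nrm n x ≤ maxNrm n x :=
  le_ciSup (f := fun s : OSStructure X => s.nrm n x)
    ⟨∑ i, ∑ j, ‖x i j‖, by rintro _ ⟨s, rfl⟩; exact s.nrm_le_sum n x⟩ s

variable (X)

/-- The maximal operator space structure on a normed space. -/
def maxStructure : OSStructure X where
  nrm n x := maxNrm n x
  nrm_nonneg n x := Real.iSup_nonneg fun s => s.nrm_nonneg n x
  nrm_add_le n x y := ciSup_le fun s =>
    (s.nrm_add_le n x y).trans (add_le_add (le_maxNrm s n x) (le_maxNrm s n y))
  nrm_smul n c x := by
    simp only [maxNrm, OSStructure.nrm_smul]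
    exact (Real.mul_iSup_of_nonneg (norm_nonneg c) _).symm
  eq_zero_of_nrm n x hx := by
    refine (minStructure X).eq_zero_of_nrm n x
      (le_antisymm ((le_maxNrm _ n x).trans hx.le) ((minStructure X).nrm_nonneg n x))
  nrm_one x := by simp [maxNrm, OSStructure.nrm_one]
  nrm_directSum m n x y := by
    refine le_antisymm (ciSup_le fun s => ?_) (max_le (ciSup_le fun s => ?_) (ciSup_le fun s => ?_))
    · rw [s.nrm_directSum]
      exact max_le_max (le_maxNrm s m x) (le_maxNrm s n y)
    · exact ((le_max_left _ _).trans (s.nrm_directSum m n x y).ge).trans (le_maxNrm s _ _)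
    · exact ((le_max_right _ _).trans (s.nrm_directSum m n x y).ge).trans (le_maxNrm s _ _)
  nrm_bimul_le n α x β := ciSup_le fun s => by
    refine (s.nrm_bimul_le n α x β).trans (mul_le_mul_of_nonneg_right ?_ (opNorm_nonneg _))
    exact mul_le_mul_of_nonneg_left (le_maxNrm s n x) (opNorm_nonneg _)

variable {X}

/-- `maxStructure X` is the largest operator space structure on `X`. -/
theorem le_maxStructure (s : OSStructure X) (n : ℕ) (x : Matrix (Fin n) (Fin n) X) :
    s.nrm n x ≤ (maxStructure X).nrm n x := le_maxNrm s n x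

end MinMax

end OperatorSpaces

open OperatorSpaces

/-! ### The category of operator spaces -/

/-- An operator space: a complex Banach space with an operator space structure. -/
structure OS : Type (u + 1) where
  carrier : Type u
  [normedAddCommGroup : NormedAddCommGroup carrier]
  [normedSpace : NormedSpace ℂ carrier]
  [completeSpace : CompleteSpace carrier]
  str : OSStructure carrier

namespace OS

attribute [instance] normedAddCommGroup normedSpace completeSpace

/-- A morphism of operator spaces is a linear complete contraction. -/
@[ext]
structure Hom (X Y : OS.{u}) : Type u where
  toLinearMap : X.carrier →ₗ[ℂ] Y.carrier
  completelyContractive : ∀ (n : ℕ) (x : Matrix (Fin n) (Fin n) X.carrier),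
    Y.str.nrm n (x.map toLinearMap) ≤ X.str.nrm n x

instance : Category.{u} OS.{u} where
  Hom := Hom
  id X := ⟨LinearMap.id, fun n x => le_of_eq (by congr 1)⟩
  comp f g := ⟨g.toLinearMap.comp f.toLinearMap, fun n x =>
    (g.completelyContractive n (x.map f.toLinearMap)).trans (f.completelyContractive n x)⟩

/-- The operator space `ℂ` (as an object in the universe `u`). -/
def complex : OS.{u} := ⟨ULift.{u} ℂ, complexStructure⟩

variable (X : Type u) [NormedAddCommGroup X] [NormedSpace ℂ X] [CompleteSpace X]

/-- The maximal quantisation `Max(X)` of a Banach space. -/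
def Max : OS.{u} := ⟨X, maxStructure X⟩

/-- The minimal quantisation `Min(X)` of a Banach space. -/
def Min : OS.{u} := ⟨X, minStructure X⟩

/-- The identity map `Max(X) → Min(X)`. -/
def idMaxMin : Max X ⟶ Min X where
  toLinearMap := (LinearMap.id : X →ₗ[ℂ] X)
  completelyContractive n x := minStructure_le (maxStructure X) n x

end OS

end

/-! A morphism from `ℂ` to `Y` is a map `c ↦ c • v` with `‖v‖ ≤ 1`, and every such `v` occurs: the
matrix with entries `a i j • v` is `a · diag(v, …, v) · 1`, so the axioms bound its norm by `opNorm
a * ‖v‖` (`OSStructure.nrm_map_smul_le`). Thus `ℂ` sees exactly the closed unit ball of the Banach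
space `Y`. The ball spans, so `ℂ` is a generator. `Max(X)` and `Min(X)` have the same ball, so every
morphism `ℂ ⟶ Min X` lifts along the identity (`exists_lift_idMaxMin`), which is injective, hence
mono.

To refute strength, one space on which the two structures differ suffices. On the Euclidean plane,
the column with entries `e₀, e₁` has minimal norm at most `1`: a functional in the dual ball turns
it into a scalar column of length at most `1`. In the column structure its norm is at least `√2`,
and the maximal norm dominates that (`min_nrm_lt_max_nrm_basisColumn`). An inverse of the identity
would force the maximal norm below the minimal one. -/

namespace OperatorSpaces

/-! ### Multiples of a vector -/

section ScalarMultiples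

variable {X : Type u} [NormedAddCommGroup X] [NormedSpace ℂ X]

theorem opNorm_one_le (n : ℕ) : opNorm (1 : Matrix (Fin n) (Fin n) ℂ) ≤ 1 :=
  opNorm_le_of _ zero_le_one fun v => by simp

/-- The norm of a diagonal matrix with constant diagonal is bounded by the norm of its entry. -/
theorem OSStructure.nrm_diagonal_le (s : OSStructure X) (v : X) (n : ℕ) :
    s.nrm n (Matrix.diagonal fun _ => v) ≤ ‖v‖ := by
  induction n with
  | zero =>
    rw [Subsingleton.elim (Matrix.diagonal fun _ => v) 0, s.nrm_zero]
    exact norm_nonneg v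
  | succ n ih =>
    have h : (Matrix.diagonal fun _ : Fin (n + 1) => v) =
        directSum (Matrix.diagonal fun _ : Fin n => v) (Matrix.of fun _ _ : Fin 1 => v) := by
      ext i j
      refine Fin.addCases (fun i => ?_) (fun i => ?_) i <;>
        refine Fin.addCases (fun j => ?_) (fun j => ?_) j <;>
        simp [directSum, Matrix.diagonal_apply, Fin.ext_iff] <;> omega
    rw [h, s.nrm_directSum, s.nrm_one]
    exact max_le ih le_rfl

theorem OSStructure.nrm_map_smul_le (s : OSStructure X) (v : X) {n : ℕ}
    (a : Matrix (Fin n) (Fin n) ℂ) : s.nrm n (a.map fun c => c • v) ≤ opNorm a * ‖v‖ := by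
  have h : bimul a (Matrix.diagonal fun _ => v) 1 = a.map fun c => c • v := by
    ext i j
    simp [bimul, Matrix.diagonal_apply, Matrix.one_apply]
  rw [← h]
  have h0 := opNorm_nonneg a
  have h1 := s.nrm_nonneg n (Matrix.diagonal fun _ => v)
  calc _ ≤ _ := s.nrm_bimul_le _ _ _ _
    _ ≤ opNorm a * ‖v‖ * 1 := by
      gcongr
      · exact opNorm_nonneg _
      · exact s.nrm_diagonal_le v n
      · exact opNorm_one_le n
    _ = _ := mul_one _

end ScalarMultiples

/-! ### The column structure of a Euclidean space -/

section Column

variable {X : Type u} [NormedAddCommGroup X] [NormedSpace ℂ X]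

/-- The operator `ℂⁿ → Xⁿ` given by a matrix over `X`. -/
noncomputable def columnOp {n : ℕ} (x : Matrix (Fin n) (Fin n) X) :
    EuclideanSpace ℂ (Fin n) →L[ℂ] PiLp 2 (fun _ : Fin n => X) :=
  LinearMap.toContinuousLinearMap
    { toFun := fun v => WithLp.toLp 2 fun i => ∑ j, v j • x i j
      map_add' := fun v w => by ext i; simp [add_smul, Finset.sum_add_distrib]
      map_smul' := fun c v => by ext i; simp [mul_smul, Finset.smul_sum] }

@[simp] theorem columnOp_apply {n : ℕ} (x : Matrix (Fin n) (Fin n) X)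
    (v : EuclideanSpace ℂ (Fin n)) (i : Fin n) : columnOp x v i = ∑ j, v j • x i j := rfl

theorem norm_sq_columnOp {n : ℕ} (x : Matrix (Fin n) (Fin n) X)
    (v : EuclideanSpace ℂ (Fin n)) : ‖columnOp x v‖ ^ 2 = ∑ i, ‖∑ j, v j • x i j‖ ^ 2 := by
  rw [PiLp.norm_sq_eq_of_L2]; rfl

theorem columnOp_add {n : ℕ} (x y : Matrix (Fin n) (Fin n) X) :
    columnOp (x + y) = columnOp x + columnOp y := by
  ext v i; simp [Finset.sum_add_distrib]

theorem columnOp_smul {n : ℕ} (c : ℂ) (x : Matrix (Fin n) (Fin n) X) :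
    columnOp (c • x) = c • columnOp x := by
  ext v i; simp [Finset.smul_sum, smul_comm c]

theorem eq_zero_of_columnOp {n : ℕ} (x : Matrix (Fin n) (Fin n) X) (h : columnOp x = 0) :
    x = 0 := by
  ext i j
  have h1 : columnOp x (EuclideanSpace.single j 1) i = 0 := by rw [h]; rfl
  simpa [Pi.single_apply, ite_smul] using h1

theorem norm_columnOp_one (v : X) : ‖columnOp (Matrix.of fun _ _ : Fin 1 => v)‖ = ‖v‖ := by
  have key : ∀ w, ‖columnOp (Matrix.of fun _ _ : Fin 1 => v) w‖ = ‖v‖ * ‖w‖ := fun w => by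
    rw [← sq_eq_sq₀ (norm_nonneg _) (by positivity), norm_sq_columnOp, mul_pow,
      EuclideanSpace.norm_sq_eq]
    simp [norm_smul, mul_pow, mul_comm]
  refine le_antisymm (ContinuousLinearMap.opNorm_le_bound _ (norm_nonneg v) fun w => (key w).le) ?_
  have h := (columnOp (Matrix.of fun _ _ : Fin 1 => v)).le_opNorm (EuclideanSpace.single 0 1)
  rw [key] at h
  simpa using h

theorem norm_sq_columnOp_directSum {m n : ℕ} (x : Matrix (Fin m) (Fin m) X)
    (y : Matrix (Fin n) (Fin n) X) (v : EuclideanSpace ℂ (Fin (m + n))) :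
    ‖columnOp (directSum x y) v‖ ^ 2 =
      ‖columnOp x (WithLp.toLp 2 fun i => v (Fin.castAdd n i))‖ ^ 2 +
      ‖columnOp y (WithLp.toLp 2 fun i => v (Fin.natAdd m i))‖ ^ 2 := by
  simp [norm_sq_columnOp, Fin.sum_univ_add, directSum]

/-- Squared lengths add over the two blocks, which gives the upper bound. Vectors supported in a
single block give the two lower bounds. -/
theorem norm_columnOp_directSum {m n : ℕ} (x : Matrix (Fin m) (Fin m) X)
    (y : Matrix (Fin n) (Fin n) X) :
    ‖columnOp (directSum x y)‖ = max ‖columnOp x‖ ‖columnOp y‖ := by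
  have hM : 0 ≤ max ‖columnOp x‖ ‖columnOp y‖ := le_max_of_le_left (norm_nonneg _)
  refine le_antisymm (ContinuousLinearMap.opNorm_le_bound _ hM fun v => ?_) (max_le ?_ ?_)
  · refine le_of_sq_le_sq ?_ (by positivity)
    have hv := norm_sq_append v.ofLp
    rw [WithLp.toLp_ofLp] at hv
    rw [mul_pow, hv, norm_sq_columnOp_directSum, mul_add, ← mul_pow, ← mul_pow]
    gcongr
    · exact (columnOp x).le_of_opNorm_le (le_max_left _ _) _
    · exact (columnOp y).le_of_opNorm_le (le_max_right _ _) _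
  · refine ContinuousLinearMap.opNorm_le_bound _ (norm_nonneg _) fun v => ?_
    have h := (columnOp (directSum x y)).le_opNorm (WithLp.toLp 2 (Fin.append v.ofLp 0))
    have h1 := norm_sq_columnOp_directSum x y (WithLp.toLp 2 (Fin.append v.ofLp 0))
    have h2 := norm_sq_append (Fin.append v.ofLp (0 : Fin n → ℂ))
    simp only [Fin.append_left, Fin.append_right, Pi.zero_apply] at h1 h2
    have h0 : ‖WithLp.toLp 2 (fun _ : Fin n => (0 : ℂ))‖ = 0 := by
      simp [EuclideanSpace.norm_eq]
    rw [h0] at h2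
    have h3 : ‖WithLp.toLp 2 (Fin.append v.ofLp (0 : Fin n → ℂ))‖ = ‖v‖ :=
      (sq_eq_sq₀ (norm_nonneg _) (norm_nonneg _)).1 (by simpa using h2)
    rw [h3] at h
    refine le_trans (le_of_sq_le_sq ?_ (norm_nonneg _)) h
    rw [h1]
    exact le_add_of_nonneg_right (by positivity)
  · refine ContinuousLinearMap.opNorm_le_bound _ (norm_nonneg _) fun v => ?_
    have h := (columnOp (directSum x y)).le_opNorm (WithLp.toLp 2 (Fin.append 0 v.ofLp))
    have h1 := norm_sq_columnOp_directSum x y (WithLp.toLp 2 (Fin.append 0 v.ofLp))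
    have h2 := norm_sq_append (Fin.append (0 : Fin m → ℂ) v.ofLp)
    simp only [Fin.append_left, Fin.append_right, Pi.zero_apply] at h1 h2
    have h0 : ‖WithLp.toLp 2 (fun _ : Fin m => (0 : ℂ))‖ = 0 := by
      simp [EuclideanSpace.norm_eq]
    rw [h0] at h2
    have h3 : ‖WithLp.toLp 2 (Fin.append (0 : Fin m → ℂ) v.ofLp)‖ = ‖v‖ :=
      (sq_eq_sq₀ (norm_nonneg _) (norm_nonneg _)).1 (by simpa using h2)
    rw [h3] at h
    refine le_trans (le_of_sq_le_sq ?_ (norm_nonneg _)) h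
    rw [h1]
    exact le_add_of_nonneg_left (by positivity)

variable {ι : Type u} [Fintype ι]

/-- The squared norm of the target splits over the coordinates `p`, and for each `p` the matrix `α`
acts on the scalar vector `(y k p)ₖ`. This is where the target being Euclidean, not merely normed,
is used. -/
theorem sum_norm_sq_smul_le {n : ℕ} (α : Matrix (Fin n) (Fin n) ℂ)
    (y : Fin n → EuclideanSpace ℂ ι) :
    ∑ i, ‖∑ k, α i k • y k‖ ^ 2 ≤ opNorm α ^ 2 * ∑ k, ‖y k‖ ^ 2 := by
  simp only [EuclideanSpace.norm_sq_eq]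
  rw [Finset.sum_comm]
  conv_rhs => rw [Finset.sum_comm, Finset.mul_sum]
  refine Finset.sum_le_sum fun p _ => ?_
  have h := pow_le_pow_left₀ (norm_nonneg _) (norm_toLp_mulVec_le α fun k => y k p) 2
  rw [mul_pow] at h
  simpa [EuclideanSpace.norm_sq_eq, Matrix.mulVec, dotProduct] using h

/-- The factorization `(α ⊗ 1) ∘ columnOp x ∘ β`, which lets the three norms be estimated
separately. -/
theorem columnOp_bimul_apply {n : ℕ} (α : Matrix (Fin n) (Fin n) ℂ)
    (x : Matrix (Fin n) (Fin n) X) (β : Matrix (Fin n) (Fin n) ℂ)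
    (v : EuclideanSpace ℂ (Fin n)) (i : Fin n) :
    columnOp (bimul α x β) v i =
      ∑ k, α i k • columnOp x (WithLp.toLp 2 (β.mulVec v.ofLp)) k := by
  simp only [columnOp_apply, bimul, Matrix.of_apply, Matrix.mulVec, dotProduct, Finset.smul_sum,
    Finset.sum_smul, smul_smul]
  rw [Finset.sum_comm]
  refine Finset.sum_congr rfl fun k _ => ?_
  rw [Finset.sum_comm]
  exact Finset.sum_congr rfl fun l _ => Finset.sum_congr rfl fun j _ => by congr 1; ring

theorem norm_columnOp_bimul_le {n : ℕ} (α : Matrix (Fin n) (Fin n) ℂ)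
    (x : Matrix (Fin n) (Fin n) (EuclideanSpace ℂ ι)) (β : Matrix (Fin n) (Fin n) ℂ) :
    ‖columnOp (bimul α x β)‖ ≤ opNorm α * ‖columnOp x‖ * opNorm β := by
  have hα := opNorm_nonneg α
  have hβ := opNorm_nonneg β
  refine ContinuousLinearMap.opNorm_le_bound _ (by positivity) fun v => ?_
  have h1 : ‖columnOp (bimul α x β) v‖ ≤
      opNorm α * ‖columnOp x (WithLp.toLp 2 (β.mulVec v.ofLp))‖ := by
    refine le_of_sq_le_sq ?_ (by positivity)
    rw [mul_pow, PiLp.norm_sq_eq_of_L2, PiLp.norm_sq_eq_of_L2]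
    simp only [columnOp_bimul_apply]
    exact sum_norm_sq_smul_le α _
  calc _ ≤ _ := h1
    _ ≤ opNorm α * (‖columnOp x‖ * (opNorm β * ‖v‖)) := by
      gcongr
      exact ((columnOp x).le_opNorm _).trans (by gcongr; exact norm_toLp_mulVec_le β v.ofLp)
    _ = _ := by ring

variable (ι) in
/-- The column operator space structure of a Euclidean space. -/
noncomputable def columnStructure : OSStructure (EuclideanSpace ℂ ι) where
  nrm n x := ‖columnOp x‖
  nrm_nonneg n x := norm_nonneg _
  nrm_add_le n x y := by rw [columnOp_add]; exact norm_add_le _ _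
  nrm_smul n c x := by rw [columnOp_smul]; exact norm_smul _ _
  eq_zero_of_nrm n x h := eq_zero_of_columnOp x (norm_eq_zero.1 h)
  nrm_one x := norm_columnOp_one x
  nrm_directSum m n x y := norm_columnOp_directSum x y
  nrm_bimul_le n α x β := norm_columnOp_bimul_le α x β

end Column

/-! ### The maximal and the minimal structure of the Euclidean plane -/

section Plane

/-- The Euclidean plane. -/
abbrev Plane : Type u := EuclideanSpace ℂ (ULift.{u} (Fin 2))

/-- The matrix whose first column is the standard basis of the plane. -/
noncomputable def basisColumn : Matrix (Fin 2) (Fin 2) Plane.{u} :=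
  Matrix.of fun i j => if j = 0 then EuclideanSpace.single (ULift.up i) 1 else 0

theorem min_nrm_basisColumn_le : (minStructure Plane.{u}).nrm 2 basisColumn ≤ 1 := by
  refine ciSup_le fun f => opNorm_le_of _ zero_le_one fun v => ?_
  -- The Riesz vector of `f`, so that `f a = ‖a‖ ^ 2`.
  set a : Plane.{u} := WithLp.toLp 2 fun p => star (f.1 (EuclideanSpace.single p 1)) with ha
  have hfa : f.1 a = ((‖a‖ ^ 2 : ℝ) : ℂ) := by
    have h : a = ∑ p, a p • EuclideanSpace.single p (1 : ℂ) := by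
      ext q
      simp [Pi.single_apply]
    rw [EuclideanSpace.norm_sq_eq]
    conv_lhs => rw [h, map_sum]
    push_cast
    refine Finset.sum_congr rfl fun p _ => ?_
    rw [map_smul, ha]
    simp [Complex.conj_mul']
  -- Since `f` is a contraction, `‖a‖ ^ 2 = ‖f a‖ ≤ ‖a‖`.
  have hle : ‖a‖ ≤ 1 := by
    have h := f.1.le_of_opNorm_le f.2 a
    rw [hfa, Complex.norm_real, norm_pow, norm_norm, one_mul] at h
    nlinarith [norm_nonneg a]
  -- The image matrix has the conjugate of `a` as first column and zero as second, so only `v 0`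
  -- enters.
  have h1 : ‖WithLp.toLp 2 ((basisColumn.map f.1).mulVec v)‖ = ‖a‖ * ‖v 0‖ := by
    rw [← sq_eq_sq₀ (norm_nonneg _) (by positivity), mul_pow, EuclideanSpace.norm_sq_eq,
      EuclideanSpace.norm_sq_eq, ← Equiv.ulift.symm.sum_comp, Finset.sum_mul]
    refine Finset.sum_congr rfl fun i _ => ?_
    simp [Matrix.mulVec, dotProduct, Fin.sum_univ_two, basisColumn, ha, mul_pow]
  rw [h1]
  gcongr
  exact PiLp.norm_apply_le (WithLp.toLp 2 v) 0

/-- The unit vector `e₀` is sent to the pair `(e₀, e₁)`, whose squared length is `2`. -/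
theorem two_le_column_nrm_basisColumn :
    2 ≤ (columnStructure (ULift.{u} (Fin 2))).nrm 2 basisColumn ^ 2 := by
  have h := (columnOp basisColumn.{u}).le_opNorm (EuclideanSpace.single 0 1)
  have h2 := norm_sq_columnOp basisColumn.{u} (EuclideanSpace.single 0 1)
  have h3 : ‖columnOp basisColumn.{u} (EuclideanSpace.single 0 1)‖ ^ 2 = 2 := by
    rw [h2]
    simp [basisColumn]
  rw [← h3]
  refine pow_le_pow_left₀ (norm_nonneg _) ?_ 2
  rwa [PiLp.norm_single, norm_one, mul_one] at h

theorem min_nrm_lt_max_nrm_basisColumn :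
    (minStructure Plane.{u}).nrm 2 basisColumn < (maxStructure Plane.{u}).nrm 2 basisColumn := by
  have h1 := min_nrm_basisColumn_le.{u}
  have h2 := two_le_column_nrm_basisColumn.{u}
  have h3 := le_maxStructure (columnStructure (ULift.{u} (Fin 2))) 2 basisColumn
  have h4 := (columnStructure (ULift.{u} (Fin 2))).nrm_nonneg 2 basisColumn
  nlinarith

end Plane

end OperatorSpaces

/-! ### Morphisms out of `ℂ` and the identity from `Max(X)` to `Min(X)` -/

namespace OS

open OperatorSpaces

/-- The morphism `c ↦ c • v` determined by a vector of the unit ball. -/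
noncomputable def ofVector (Y : OS.{u}) (v : Y.carrier) (hv : ‖v‖ ≤ 1) : complex.{u} ⟶ Y where
  toLinearMap := (LinearMap.toSpanSingleton ℂ Y.carrier v).comp down
  completelyContractive n x := by
    have h := Y.str.nrm_map_smul_le v (x.map down)
    exact h.trans (mul_le_of_le_one_right (opNorm_nonneg _) hv)

theorem hom_ext {X Y : OS.{u}} {f g : X ⟶ Y}
    (h : ∀ x : X.carrier, f.toLinearMap x = g.toLinearMap x) : f = g :=
  Hom.ext (LinearMap.ext h)

theorem comp_toLinearMap_apply {X Y Z : OS.{u}} (f : X ⟶ Y) (g : Y ⟶ Z) (x : X.carrier) :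
    (f ≫ g).toLinearMap x = g.toLinearMap (f.toLinearMap x) := rfl

theorem ofVector_apply (Y : OS.{u}) (v : Y.carrier) (hv : ‖v‖ ≤ 1) (c : ULift.{u} ℂ) :
    (ofVector Y v hv).toLinearMap c = c.down • v := rfl

theorem norm_toLinearMap_le {X Y : OS.{u}} (f : X ⟶ Y) (x : X.carrier) :
    ‖f.toLinearMap x‖ ≤ ‖x‖ := by
  rw [← Y.str.nrm_one, ← X.str.nrm_one]
  exact f.completelyContractive 1 (Matrix.of fun _ _ => x)

theorem isSeparator_complex : IsSeparator complex.{u} := by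
  rw [isSeparator_def]
  refine fun X Y f g h => hom_ext fun x => ?_
  rcases eq_or_ne x 0 with rfl | hx
  · simp
  have hn : (‖x‖ : ℂ) ≠ 0 := by exact_mod_cast norm_ne_zero_iff.2 hx
  -- Only vectors of the unit ball define morphisms, so `x` is normalized and then recovered as the
  -- image of the scalar `‖x‖`.
  have hv : ‖(‖x‖ : ℂ)⁻¹ • x‖ ≤ 1 := by
    rw [norm_smul, norm_inv, Complex.norm_real, norm_norm, inv_mul_cancel₀ (norm_ne_zero_iff.2 hx)]
  have h1 := congrArg (fun k : complex.{u} ⟶ Y => k.toLinearMap (ULift.up (‖x‖ : ℂ)))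
    (h (ofVector X _ hv))
  have h2 : (ofVector X _ hv).toLinearMap (ULift.up (‖x‖ : ℂ)) = x :=
    (ofVector_apply X _ hv _).trans (smul_inv_smul₀ hn x)
  have h3 := (comp_toLinearMap_apply (ofVector X _ hv) f (ULift.up (‖x‖ : ℂ))).symm.trans
    (h1.trans (comp_toLinearMap_apply (ofVector X _ hv) g (ULift.up (‖x‖ : ℂ))))
  rwa [h2] at h3

variable (X : Type u) [NormedAddCommGroup X] [NormedSpace ℂ X] [CompleteSpace X]

instance mono_idMaxMin : Mono (idMaxMin X) where
  right_cancellation _ _ e := hom_ext fun x =>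
    congrArg (fun k : _ ⟶ Min X => k.toLinearMap x) e

/-- The lift is given by the same vector, the image of `1`: its norm is at most `1`, and the Banach
norms of `Max X` and `Min X` coincide. -/
theorem exists_lift_idMaxMin (f : complex.{u} ⟶ Min X) :
    ∃ g : complex.{u} ⟶ Max X, g ≫ idMaxMin X = f := by
  have h1 : ‖(ULift.up 1 : ULift.{u} ℂ)‖ ≤ 1 := norm_one.le
  have hv : ‖f.toLinearMap (ULift.up 1)‖ ≤ 1 := (norm_toLinearMap_le f (ULift.up 1)).trans h1
  refine ⟨ofVector (Max X) (f.toLinearMap (ULift.up 1)) hv, hom_ext fun c => ?_⟩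
  have h2 : c.down • (ULift.up 1 : ULift.{u} ℂ) = c := ULift.ext _ _ (mul_one c.down)
  exact (f.toLinearMap.map_smul c.down (ULift.up 1 : ULift.{u} ℂ)).symm.trans
    (congrArg f.toLinearMap h2)

/-- The inverse also has the identity as underlying map, and its complete contractivity is this
inequality. -/
theorem max_nrm_le_min_nrm_of_isIso [IsIso (idMaxMin X)] (n : ℕ) (x : Matrix (Fin n) (Fin n) X) :
    (maxStructure X).nrm n x ≤ (minStructure X).nrm n x := by
  have h : x.map (inv (idMaxMin X)).toLinearMap = x := by
    ext i j
    exact congrArg (fun k : Min X ⟶ Min X => k.toLinearMap (x i j))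
      (IsIso.inv_hom_id (idMaxMin X))
  have h1 := (inv (idMaxMin X)).completelyContractive n x
  exact (congrArg ((maxStructure X).nrm n) h).ge.trans h1

theorem not_isIso_idMaxMin_plane : ¬ IsIso (idMaxMin Plane.{u}) := fun _ =>
  (max_nrm_le_min_nrm_of_isIso Plane.{u} 2 basisColumn).not_gt min_nrm_lt_max_nrm_basisColumn

theorem not_isStrongGenerator_complex :
    ¬ (ObjectProperty.singleton complex.{u}).IsStrongGenerator := by
  -- A monomorphism through which all morphisms from a strong generator factor is an isomorphism.
  refine fun h => not_isIso_idMaxMin_plane.{u} (h.isIso_of_mono _ fun G hG f => ?_)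
  obtain rfl := (ObjectProperty.singleton_iff _ _).1 hG
  exact exists_lift_idMaxMin Plane.{u} f

end OS

theorem mainTheorem10 :
    (IsSeparator OS.complex.{u} ∧
      ¬ (ObjectProperty.singleton OS.complex.{u}).IsStrongGenerator) ∧
    ∀ (X : Type u) [NormedAddCommGroup X] [NormedSpace ℂ X] [CompleteSpace X],
      IsEmpty (OS.Max X ≅ OS.Min X) →
        (Mono (OS.idMaxMin X) ∧ ¬ IsIso (OS.idMaxMin X)) ∧
        ∀ f : OS.complex.{u} ⟶ OS.Min X, ∃ g : OS.complex.{u} ⟶ OS.Max X,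
          g ≫ OS.idMaxMin X = f :=
  ⟨⟨OS.isSeparator_complex, OS.not_isStrongGenerator_complex⟩, fun X _ _ _ h =>
    -- If the identity were invertible, it would itself be an isomorphism of the excluded kind.
    ⟨⟨inferInstance, fun _ => h.false (asIso (OS.idMaxMin X))⟩, OS.exists_lift_idMaxMin X⟩⟩
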